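/- Let $N\ge 1$, $n\ge 0$, $A\in\mathbb R^{n\times n}$, $b,c\in\mathbb R^n$. Let $\mathcal D$ be a weighted directed graph on $\{1,\dots,N\}$ with real edge weights. Its adjacency matrix $A_{\mathcal D}$ has as $(i,j)$ entry the weight of the edge from $j$ to $i$ (and $0$ if there is no such edge), and its Laplacian is $L_{\mathcal D}=D_{\mathcal D}-A_{\mathcal D}$, where $D_{\mathcal D}$ is the diagonal matrix of weighted in-degrees. Put $\mathbf G=-L_{\mathcal D}$ and consider the network $$\dot{\mathbf x}(t)=\left(I_N\otimes A+\mathbf G\otimes bc^T\right)\mathbf x(t)+(I_N\otimes b)\,\mathbf w(t),\qquad \mathbf y(t)=(I_N\otimes c^T)\,\mathbf x(t),$$ where $I_N\otimes A+\mathbf G\otimes bc^T$ is Hurwitz. For jointly wide-sense stationary (WSS) real processes write $R_{uv}(\tau)=\mathbb E(u(t)v(t-\tau))$ and $S_{uv}(\omega)=\int_{\mathbb R}R_{uv}(\tau)e^{-\mathbf j\omega\tau}\,d\tau$. Assume: (A1) the inputs $w_1,\dots,w_N$ are jointly measurable in time and outcome, zero-mean, WSS and mutually uncorrelated, with one common autocorrelation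 function $R_w(\tau)=\mathbb E(w_i(t)w_i(t+\tau))$, which is integrable, so that the power spectral density (PSD) $S_w(\omega)=\int_{\mathbb R} R_w(\tau)e^{-\mathbf j\omega\tau}\,d\tau$ exists; (A2) there is $\Omega>0$ with $S_w(\omega)>0$ for all $\omega\in(-\Omega,\Omega)$. Let $\mathbf x$ be the steady-state response of the network, that is, a process on the whole time axis $\mathbb R$ with second moments bounded uniformly in time and almost all of whose paths solve the equation (are continuous and satisfy the integrated equation). Then the outputs $y_1,\dots,y_N$ are jointly WSS with integrable cross-correlation functions. Let $\mathbf S(\omega)=[S_{y_iy_j}(\omega)]$ be the matrix of their cross-power spectral densities and $h(\mathbf j\omega)=c^T(\mathbf j\omega I_n-A)^{-1}b$ the nodal transfer function. For every $\omega\in\mathbb R$ with $S_w(\omega)\neq 0$ (in particular for every $\omega\in(-\Omega,\Omega)$) and $h(\mathbf j\omega)\ne 0$, the matrix $\mathbf S(\omega)$ is invertible, $\mathbf 1^T\mathbf S^{-1}(\omega)\mathbf 1\neq 0$, and $$S_w(\omega)=\frac{N}{\left(\mathbf 1^T\mathbf S^{-1}(\omega)\mathbf 1\right)|h(\mathbf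 j\omega)|^2}.$$ -/

import Mathlib

open MeasureTheory Matrix Set
open scoped Kronecker

noncomputable section

/-- A weighted directed graph on the vertex set `V`: a set of ordered pairs (the edge `(u, v)` goes
from `u` to `v`) and a real weight for every edge. -/
structure WeightedDigraph (V : Type*) where
  edges : Set (V × V)
  weight : edges → ℝ

namespace WeightedDigraph

variable {V : Type*}

open Classical in
/-- The weight of an ordered pair: the weight of the edge, and `0` if it is not an edge. -/
def pairWeight (D : WeightedDigraph V) (p : V × V) : ℝ :=
  if h : p ∈ D.edges then D.weight ⟨p, h⟩ else 0

/-- The adjacency matrix: the `(i, j)` entry is the weight of the edge from `j` to `i`. -/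
def adjacency (D : WeightedDigraph V) : Matrix V V ℝ :=
  Matrix.of fun i j => D.pairWeight (j, i)

/-- The weighted in-degree of `i`: the sum of the weights of the edges that end in `i`. -/
def inDegree [Fintype V] (D : WeightedDigraph V) (i : V) : ℝ :=
  ∑ j, D.pairWeight (j, i)

/-- The directed Laplacian: the in-degree matrix minus the adjacency matrix. -/
def laplacian [Fintype V] [DecidableEq V] (D : WeightedDigraph V) : Matrix V V ℝ :=
  Matrix.diagonal D.inDegree - D.adjacency

end WeightedDigraph

/-- The network state matrix `I_N ⊗ A + G ⊗ b cᵀ`. -/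
def networkStateMatrix {N n : ℕ} (A : Matrix (Fin n) (Fin n) ℝ) (b c : Fin n → ℝ)
    (G : Matrix (Fin N) (Fin N) ℝ) : Matrix (Fin N × Fin n) (Fin N × Fin n) ℝ :=
  (1 : Matrix (Fin N) (Fin N) ℝ) ⊗ₖ A + G ⊗ₖ Matrix.vecMulVec b c

/-- A real square matrix is Hurwitz if all its complex eigenvalues have negative real part. -/
def IsHurwitz {ι : Type*} [Fintype ι] [DecidableEq ι] (M : Matrix ι ι ℝ) : Prop :=
  ∀ z ∈ spectrum ℂ (M.map Complex.ofReal), z.re < 0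

/-- `x` is a trajectory on the whole time axis of
`x' = (I_N ⊗ A + G ⊗ b cᵀ) x + (I_N ⊗ b) w`, in the sense of Carathéodory: the input is locally
integrable, `x` is continuous, and the integrated equation holds. The entry of `(I_N ⊗ b) w` at
`p = (i, k)` is `b k * w i`. -/
structure IsNetworkTrajectory {N n : ℕ} (A : Matrix (Fin n) (Fin n) ℝ) (b c : Fin n → ℝ)
    (G : Matrix (Fin N) (Fin N) ℝ) (w : Fin N → ℝ → ℝ) (x : ℝ → Fin N × Fin n → ℝ) : Prop where
  locallyIntegrable_input : ∀ i, LocallyIntegrable (w i) volume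
  continuous_state : Continuous x
  integral_eq : ∀ s t : ℝ, x t = x s + ∫ r in s..t,
    (networkStateMatrix A b c G *ᵥ x r + fun p : Fin N × Fin n => b p.2 * w p.1 r)

/-- The network output `y = (I_N ⊗ cᵀ) x`, as a family of processes. -/
def networkOutput {N n : ℕ} {Ω : Type*} (c : Fin n → ℝ) (x : ℝ → Ω → Fin N × Fin n → ℝ) :
    Fin N → ℝ → Ω → ℝ :=
  fun i t o => ∑ k, c k * x t o (i, k)

/-- The nodal transfer function on the imaginary axis, `h(jω) = cᵀ (jω I_n - A)⁻¹ b`. -/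
def nodalTransfer {n : ℕ} (A : Matrix (Fin n) (Fin n) ℝ) (b c : Fin n → ℝ) (ω : ℝ) : ℂ :=
  (fun k => (c k : ℂ)) ⬝ᵥ
    (((Complex.I * (ω : ℂ)) • (1 : Matrix (Fin n) (Fin n) ℂ) - A.map Complex.ofReal)⁻¹ *ᵥ
      fun k => (b k : ℂ))

/-- The Fourier transform in angular frequency, `∫ R(τ) exp(-jωτ) dτ`. Applied to an
auto-correlation function it gives the power spectral density, applied to a cross-correlation
function the cross-power spectral density. -/
def spectralDensity (R : ℝ → ℝ) (ω : ℝ) : ℂ :=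
  ∫ τ : ℝ, (R τ : ℂ) * Complex.exp (-(Complex.I * (ω : ℂ) * (τ : ℂ)))

section Processes

variable {Ω : Type*} [MeasurableSpace Ω]

/-- A family of real processes is jointly wide-sense stationary: finite second moments, constant
means, and all correlations `E(y_i(t) y_j(t + τ))` independent of `t`. -/
structure JointlyWSS {ι : Type*} (μ : Measure Ω) (y : ι → ℝ → Ω → ℝ) : Prop where
  memLp : ∀ i t, MemLp (y i t) 2 μ
  mean_eq : ∀ i s t, ∫ o, y i s o ∂μ = ∫ o, y i t o ∂μ
  corr_eq : ∀ i j s t τ,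
    ∫ o, y i s o * y j (s + τ) o ∂μ = ∫ o, y i t o * y j (t + τ) o ∂μ

/-- The correlation function `R_{uv}(τ) = E(u(t) v(t - τ))` of two jointly wide-sense stationary
processes, evaluated at the reference time `t = 0`. -/
def crossCorrelation (μ : Measure Ω) (u v : ℝ → Ω → ℝ) (τ : ℝ) : ℝ :=
  ∫ o, u 0 o * v (0 - τ) o ∂μ

/-- The matrix of cross-power spectral densities of a family of processes. -/
def cpsdMatrix {N : ℕ} (μ : Measure Ω) (y : Fin N → ℝ → Ω → ℝ) (ω : ℝ) :
    Matrix (Fin N) (Fin N) ℂ :=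
  Matrix.of fun i j => spectralDensity (crossCorrelation μ (y i) (y j)) ω

/-- The signals `w i` are zero-mean wide-sense stationary processes, mutually uncorrelated, with
the same auto-correlation function `R`. -/
structure UncorrelatedWSSNoise {N : ℕ} (μ : Measure Ω) (w : Fin N → ℝ → Ω → ℝ) (R : ℝ → ℝ) :
    Prop where
  memLp : ∀ i t, MemLp (w i t) 2 μ
  mean_zero : ∀ i t, ∫ o, w i t o ∂μ = 0
  autocorr : ∀ i t τ, ∫ o, w i t o * w i (t + τ) o ∂μ = R τ
  uncorrelated : ∀ i j, i ≠ j → ∀ s t, ∫ o, w i s o * w j t o ∂μ = 0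

/-- The state process has finite second moments that are bounded uniformly over the whole time
axis, so that the network is in its steady state. -/
def MeanSquareBounded {ι : Type*} [Fintype ι] (μ : Measure Ω) (x : ℝ → Ω → ι → ℝ) : Prop :=
  (∀ t p, MemLp (fun o => x t o p) 2 μ) ∧ ∃ K : ℝ, ∀ t p, ∫ o, (x t o p) ^ 2 ∂μ ≤ K

end Processes

/-- `(-W, W)` is an excitation frequency interval for the common power spectral density of the
inputs, which is the Fourier transform of `R` (real-valued, since an auto-correlation function is
even). -/
def IsExcitationInterval (R : ℝ → ℝ) (W : ℝ) : Prop :=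
  0 < W ∧ ∀ ω ∈ Ioo (-W) W, 0 < (spectralDensity R ω).re

end

/-! ### Integration by parts for Carathéodory solutions -/

section AbsolutelyContinuous

/-! Write `M` for the state matrix. For a fixed square-integrable `Z`, pairing the state equation
with `Z` and using Fubini shows that `t ↦ E(x(t) Z)` is a bounded solution on the whole line of the
same linear equation, now deterministic, with forcing `b E(w(t) Z)`
(`correlation_isBoundedSolution`). Since `M` is Hurwitz, bounded solutions are unique, and they are
integrable when the forcing is (`IsHurwitz.solution_unique`, `IsHurwitz.integrable_solution`). With
`Z = 1` this gives zero mean; with `Z = w_j(s)` and then `Z = x_q(s)`, translates of the forcing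
give translates of the solution, hence stationarity, and integrability makes the spectral densities
exist. No impulse response is needed.

A Fourier transform turns these equations into algebra (`IsBoundedSolution.fourier_eq`). Let `T` be
the cross-spectral matrix of outputs with inputs, `S` that of the outputs, `R` the input density and
`Q = 1 - hG`. Eliminating the nodal states gives `QT = hR·1` and `QS = hTᴴ`, so `Q S Qᴴ = |h|² R·1`
and `S⁻¹ = Qᴴ Q / (|h|² R)`. The rows of the Laplacian sum to zero, so `Q` fixes the all-ones
vector, and the sum of the entries of `S⁻¹` is `N / (|h|² R)` (`cpsd_inverse_of_feedback`). -/

theorem LocallyIntegrable.intervalIntegrable_real {E : Type*} [NormedAddCommGroup E]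
    {v : ℝ → E} (hv : LocallyIntegrable v volume) (a b : ℝ) : IntervalIntegrable v volume a b :=
  (hv.integrableOn_isCompact isCompact_uIcc).intervalIntegrable

open Filter Topology AbsolutelyContinuousOnInterval

/-- Each increment is bounded by the corresponding increment of the primitive of `‖v‖`, which
reduces the claim to the scalar case. -/
theorem absolutelyContinuousOnInterval_primitive {E : Type*} [NormedAddCommGroup E]
    [NormedSpace ℝ E] {v : ℝ → E} (hv : LocallyIntegrable v volume) (a b : ℝ) :
    AbsolutelyContinuousOnInterval (fun t => ∫ r in a..t, v r) a b := by
  have hi : ∀ s t : ℝ, IntervalIntegrable v volume s t :=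
    LocallyIntegrable.intervalIntegrable_real hv
  have h := (hi a b).norm.absolutelyContinuousOnInterval_intervalIntegral (c := a) (by simp)
  refine squeeze_zero (fun _ => Finset.sum_nonneg fun _ _ => dist_nonneg) (fun I => ?_) h
  refine Finset.sum_le_sum fun i _ => ?_
  rw [dist_eq_norm, dist_eq_norm, intervalIntegral.integral_interval_sub_left (hi _ _) (hi _ _),
    intervalIntegral.integral_interval_sub_left (hi _ _).norm (hi _ _).norm, Real.norm_eq_abs]
  exact intervalIntegral.norm_integral_le_abs_integral_norm

variable {E : Type*} [NormedAddCommGroup E] [NormedSpace ℂ E] [CompleteSpace E]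

/-- Since `v` is only locally integrable, `u` is differentiable only almost everywhere. The
difference of the two sides is absolutely continuous with derivative zero almost everywhere, hence
constant. -/
theorem smul_sub_smul_eq_integral_of_primitive {φ φ' : ℝ → ℂ} (hφ : ∀ t, HasDerivAt φ (φ' t) t)
    (hφ' : Continuous φ') {u v : ℝ → E} (hv : LocallyIntegrable v volume)
    (hu : ∀ s t, u t = u s + ∫ r in s..t, v r) (s t : ℝ) :
    φ t • u t - φ s • u s = ∫ r in s..t, (φ' r • u r + φ r • v r) := by
  have hφc : Continuous φ := continuous_iff_continuousAt.2 fun t => (hφ t).continuousAt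
  have huac : AbsolutelyContinuousOnInterval u s t := by
    have h1 : u = (fun _ => u s) + fun t => ∫ r in s..t, v r := funext fun t => hu s t
    rw [h1]
    exact (contDiffOn_const (c := u s)).absolutelyContinuousOnInterval.add
      (absolutelyContinuousOnInterval_primitive hv s t)
  have hucont : Continuous u := by
    have h1 : u = fun t => u s + ∫ r in s..t, v r := funext fun t => hu s t
    rw [h1]
    exact continuous_const.add
      (intervalIntegral.continuous_primitive (LocallyIntegrable.intervalIntegrable_real hv) s)
  have hφac : AbsolutelyContinuousOnInterval φ s t := by
    refine ContDiffOn.absolutelyContinuousOnInterval (ContDiff.contDiffOn ?_)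
    rw [contDiff_one_iff_deriv]
    refine ⟨fun t => (hφ t).differentiableAt, ?_⟩
    rwa [show deriv φ = φ' from funext fun t => (hφ t).deriv]
  have hloc : LocallyIntegrable (fun r => φ' r • u r + φ r • v r) volume := by
    refine (hφ'.smul hucont).locallyIntegrable.add ?_
    exact hv.continuous_smul hφc
  set F : ℝ → E := fun t => φ t • u t - ∫ r in s..t, (φ' r • u r + φ r • v r) with hF
  have hFac : AbsolutelyContinuousOnInterval F s t :=
    (hφac.smul huac).sub (absolutelyContinuousOnInterval_primitive hloc s t)
  obtain ⟨C, hC⟩ := hFac.const_of_ae_hasDerivAt_zero (by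
    filter_upwards [LocallyIntegrable.ae_hasDerivAt_integral hv,
      LocallyIntegrable.ae_hasDerivAt_integral hloc] with x h1 h2 _
    have h3 : HasDerivAt u (v x) x := by
      have h4 : u = fun t => u s + ∫ r in s..t, v r := funext fun t => hu s t
      rw [h4]
      exact (h1 s).const_add _
    have h5 := ((hφ x).smul h3).sub (h2 s)
    convert! h5 using 1
    abel)
  have e1 := hC s left_mem_uIcc
  have e2 := hC t right_mem_uIcc
  rw [← e1] at e2
  simp only [hF, intervalIntegral.integral_same, sub_zero] at e2
  rw [← e2]
  abel

end AbsolutelyContinuous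

/-! ### Bounded solutions on the whole line -/

section BoundedSolution

open Filter Topology

variable {E : Type*} [NormedAddCommGroup E] [NormedSpace ℂ E]

/-- `u` is a bounded continuous solution on the whole line of `u' = M u + g`, in integrated form. -/
structure IsBoundedSolution (M : E →L[ℂ] E) (g u : ℝ → E) : Prop where
  continuous : Continuous u
  bounded : ∃ C, ∀ t, ‖u t‖ ≤ C
  integral_eq : ∀ s t, u t = u s + ∫ r in s..t, (M (u r) + g r)

namespace IsBoundedSolution

variable {M : E →L[ℂ] E} {g u : ℝ → E}

theorem locallyIntegrable (h : IsBoundedSolution M g u) (hg : Integrable g volume) :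
    LocallyIntegrable (fun r => M (u r) + g r) volume :=
  (M.continuous.comp h.continuous).locallyIntegrable.add hg.locallyIntegrable

theorem map [CompleteSpace E] (h : IsBoundedSolution M g u) (hg : Integrable g volume)
    {P : E →L[ℂ] E} (hP : Commute P M) : IsBoundedSolution M (fun r => P (g r)) (fun r => P (u r)) where
  continuous := P.continuous.comp h.continuous
  bounded := by
    obtain ⟨C, hC⟩ := h.bounded
    exact ⟨‖P‖ * C, fun t => (P.le_opNorm _).trans
      (mul_le_mul_of_nonneg_left (hC t) (norm_nonneg _))⟩
  integral_eq s t := by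
    rw [h.integral_eq s t, map_add, ← P.intervalIntegral_comp_comm
      (LocallyIntegrable.intervalIntegrable_real (h.locallyIntegrable hg) s t)]
    congr 1
    refine intervalIntegral.integral_congr fun r _ => ?_
    have := congrArg (fun Q : E →L[ℂ] E => Q (u r)) hP.eq
    simpa using this

theorem sub {g' u' : ℝ → E} (h : IsBoundedSolution M g u) (h' : IsBoundedSolution M g' u')
    (hg : LocallyIntegrable g volume) (hg' : LocallyIntegrable g' volume) :
    IsBoundedSolution M (fun r => g r - g' r) (fun r => u r - u' r) where
  continuous := h.continuous.sub h'.continuous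
  bounded := by
    obtain ⟨C, hC⟩ := h.bounded
    obtain ⟨C', hC'⟩ := h'.bounded
    exact ⟨C + C', fun t => (norm_sub_le _ _).trans (add_le_add (hC t) (hC' t))⟩
  integral_eq s t := by
    have i1 := LocallyIntegrable.intervalIntegrable_real
      ((M.continuous.comp h.continuous).locallyIntegrable.add hg) s t
    have i2 := LocallyIntegrable.intervalIntegrable_real
      ((M.continuous.comp h'.continuous).locallyIntegrable.add hg') s t
    rw [h.integral_eq s t, h'.integral_eq s t, add_sub_add_comm]
    refine congrArg _ ((intervalIntegral.integral_sub i1 i2).symm.trans ?_)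
    refine intervalIntegral.integral_congr fun r _ => ?_
    simp only [map_sub, Pi.add_apply, Function.comp]
    abel

theorem comp_add (h : IsBoundedSolution M g u) (a : ℝ) :
    IsBoundedSolution M (fun r => g (r + a)) (fun r => u (r + a)) where
  continuous := h.continuous.comp (continuous_add_const a)
  bounded := h.bounded.imp fun _ hC t => hC _
  integral_eq s t := by
    rw [h.integral_eq (s + a) (t + a),
      ← intervalIntegral.integral_comp_add_right (fun r => M (u r) + g r)]

/-- The integral of `exp (a (t - r)) ‖g r‖` over `r ≤ t`. -/
noncomputable def decayMajorant {F : Type*} [NormedAddCommGroup F] (a : ℝ) (g : ℝ → F) (t : ℝ) : ℝ :=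
  ∫ r, (Ici (0 : ℝ)).indicator (fun q => Real.exp (a * q)) (t - r) * ‖g r‖

theorem integrable_indicator_exp {a : ℝ} (ha : a < 0) :
    Integrable ((Ici (0 : ℝ)).indicator fun q => Real.exp (a * q)) volume := by
  rw [integrable_indicator_iff measurableSet_Ici]
  exact (integrableOn_Ici_iff_integrableOn_Ioi).2 (integrableOn_exp_mul_Ioi ha 0)

theorem integrable_decayMajorant {F : Type*} [NormedAddCommGroup F] {f : ℝ → F} {a : ℝ}
    (ha : a < 0) (hg : Integrable f volume) :
    Integrable (decayMajorant a f) volume := by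
  have h := hg.norm.integrable_convolution (ContinuousLinearMap.mul ℝ ℝ)
    (integrable_indicator_exp ha)
  refine h.congr (Eventually.of_forall fun t => ?_)
  simp only [convolution_def, decayMajorant, ContinuousLinearMap.mul_apply']
  exact integral_congr_ae (Eventually.of_forall fun r => mul_comm _ _)

/-- Variation of constants from `s` to `t`, then `s → -∞`: boundedness of `u` and the decay of the
exponential remove the initial value. -/
theorem norm_le_decayMajorant [CompleteSpace E] {l : ℂ} (hl : l.re < 0)
    (hg : Integrable g volume) (h : IsBoundedSolution (l • (1 : E →L[ℂ] E)) g u) (t : ℝ) :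
    ‖u t‖ ≤ decayMajorant l.re g t := by
  obtain ⟨C, hC⟩ := h.bounded
  set κ : ℝ → ℝ := fun r => (Ici (0 : ℝ)).indicator (fun q => Real.exp (l.re * q)) (t - r) with hκ
  have hκ0 : ∀ r, 0 ≤ κ r := fun r => indicator_nonneg (fun _ _ => (Real.exp_pos _).le) _
  have hκm : Measurable κ :=
    ((Real.continuous_exp.comp (continuous_const_mul l.re)).measurable.indicator
      measurableSet_Ici).comp (measurable_const.sub measurable_id)
  have hκ1 : ∀ r, ‖κ r‖ ≤ 1 := by
    intro r
    rw [Real.norm_of_nonneg (hκ0 r)]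
    refine indicator_apply_le' (fun hq => ?_) (fun _ => zero_le_one)
    exact Real.exp_le_one_iff.2 (mul_nonpos_of_nonpos_of_nonneg hl.le hq)
  have hint : Integrable (fun r => κ r * ‖g r‖) volume :=
    hg.norm.bdd_mul hκm.aestronglyMeasurable (Eventually.of_forall hκ1)
  have key : ∀ s ≤ t, ‖u t‖ ≤ Real.exp (l.re * (t - s)) * C + decayMajorant l.re g t := by
    intro s hst
    -- The integrating factor is chosen so that its derivative cancels the term `l • u`.
    have h1 := smul_sub_smul_eq_integral_of_primitive
      (φ := fun r => Complex.exp (l * (t - r))) (φ' := fun r => -l * Complex.exp (l * (t - r)))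
      (fun r => by
        have : HasDerivAt (fun r : ℝ => l * ((t : ℂ) - r)) (-l) r := by
          simpa using ((Complex.ofRealCLM.hasDerivAt (x := r)).const_sub (t : ℂ)).const_mul l
        simpa [mul_comm] using this.cexp) (by fun_prop)
      (h.locallyIntegrable hg) h.integral_eq s t
    have h2 : u t = Complex.exp (l * (t - s)) • u s
        + ∫ r in s..t, Complex.exp (l * (t - r)) • g r := by
      rw [← sub_eq_iff_eq_add']
      simp only [sub_self, mul_zero, Complex.exp_zero, one_smul] at h1
      rw [h1]
      refine intervalIntegral.integral_congr fun r _ => ?_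
      simp [smul_add, smul_smul, mul_comm]
    have hn : ∀ r : ℝ, ‖Complex.exp (l * (t - r))‖ = Real.exp (l.re * (t - r)) := by
      intro r
      rw [Complex.norm_exp, ← Complex.ofReal_sub, Complex.re_mul_ofReal]
    rw [h2]
    refine (norm_add_le _ _).trans (add_le_add ?_ ?_)
    · rw [norm_smul, hn]
      exact mul_le_mul_of_nonneg_left (hC s) (Real.exp_pos _).le
    · rw [intervalIntegral.integral_of_le hst]
      have hpt : ∀ r ∈ Ioc s t, ‖Complex.exp (l * (t - r)) • g r‖ = κ r * ‖g r‖ := by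
        intro r hr
        rw [norm_smul, hn, hκ]
        simp only
        rw [indicator_of_mem (mem_Ici.2 (sub_nonneg.2 hr.2))]
      refine (norm_integral_le_integral_norm _).trans ?_
      rw [setIntegral_congr_fun measurableSet_Ioc hpt]
      exact setIntegral_le_integral hint
        (Eventually.of_forall fun r => mul_nonneg (hκ0 r) (norm_nonneg _))
  have hlim : Tendsto (fun s => Real.exp (l.re * (t - s)) * C + decayMajorant l.re g t) atBot
      (𝓝 (0 * C + decayMajorant l.re g t)) := by
    refine ((Real.tendsto_exp_atBot.comp ?_).mul_const C).add_const _
    refine Tendsto.const_mul_atTop_of_neg hl ?_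
    exact tendsto_atTop_add_const_left _ _ tendsto_neg_atBot_atTop
  rw [zero_mul, zero_add] at hlim
  exact ge_of_tendsto hlim ((eventually_le_atBot t).mono key)

theorem integrable_and_eq_zero_of_scalar [CompleteSpace E] {l : ℂ} (hl : l.re < 0)
    (hg : Integrable g volume) (h : IsBoundedSolution (l • (1 : E →L[ℂ] E)) g u) :
    Integrable u volume ∧ (g = 0 → u = 0) := by
  refine ⟨(integrable_decayMajorant hl hg).mono' h.continuous.aestronglyMeasurable
    (Eventually.of_forall (norm_le_decayMajorant hl hg h)), ?_⟩
  rintro rfl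
  funext t
  have := norm_le_decayMajorant hl hg h t
  simpa [decayMajorant] using this

/-- A bounded solution is integrable if the forcing is, and vanishes if the forcing does, as soon
as `M` is annihilated by a product of factors `M - l` with `l` in the open left half-plane. -/
theorem integrable_and_eq_zero [CompleteSpace E] (L : List ℂ) (hL : ∀ l ∈ L, l.re < 0)
    {g u : ℝ → E} (hg : Integrable g volume) (h : IsBoundedSolution M g u)
    (hu : ∀ t, (L.map fun l => M - l • (1 : E →L[ℂ] E)).prod (u t) = 0) :
    Integrable u volume ∧ (g = 0 → u = 0) := by
  induction L generalizing g u with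
  | nil =>
    have : u = 0 := funext fun t => by simpa using hu t
    subst this
    exact ⟨integrable_zero _ _ _, fun _ => rfl⟩
  | cons l L ih =>
    set P : E →L[ℂ] E := M - l • (1 : E →L[ℂ] E) with hP
    have hcomm : ∀ l' : ℂ, Commute (M - l' • (1 : E →L[ℂ] E)) M := fun l' =>
      (Commute.refl M).sub_left ((Commute.one_left M).smul_left l')
    -- `P u` is a bounded solution with forcing `P g`, because `P` commutes with `M`, and the
    -- shorter product annihilates it.
    have hv := ih (fun l' hl' => hL l' (List.mem_cons_of_mem _ hl')) (P.integrable_comp hg)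
      (h.map hg (hcomm l)) (by
        intro t
        have hc : Commute P (L.map fun l => M - l • (1 : E →L[ℂ] E)).prod := by
          refine Commute.list_prod_right _ _ fun Q hQ => ?_
          obtain ⟨l', -, rfl⟩ := List.mem_map.1 hQ
          exact (hcomm l).sub_right ((Commute.one_right P).smul_right l')
        have h1 := hu t
        rw [List.map_cons, List.prod_cons, ← hP, hc.eq] at h1
        exact h1)
    have hgs : Integrable (fun r => P (u r) + g r) volume := hv.1.add hg
    -- Since `M u = l u + P u`, `u` solves a scalar equation in which `P u`, already known to be
    -- integrable, joins the forcing.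
    have hsol : IsBoundedSolution (l • (1 : E →L[ℂ] E)) (fun r => P (u r) + g r) u := by
      refine ⟨h.continuous, h.bounded, fun s t => ?_⟩
      rw [h.integral_eq s t]
      congr 1
      refine intervalIntegral.integral_congr fun r _ => ?_
      simp only [hP, _root_.sub_apply]
      abel
    obtain ⟨h1, h2⟩ := integrable_and_eq_zero_of_scalar (hL l List.mem_cons_self) hgs hsol
    refine ⟨h1, fun hg0 => h2 ?_⟩
    subst hg0
    have := hv.2 (funext fun r => by simp)
    funext r
    simpa using congrFun this r

end IsBoundedSolution

end BoundedSolution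

/-! ### Hurwitz systems and their Fourier transforms -/

section HurwitzSolution

open Filter Topology

/-- Integrability of `v` gives `u` limits at both ends; integrability of `u` forces them to vanish,
since half-lines have infinite measure. -/
theorem integral_deriv_eq_zero_of_integrable {E : Type*} [NormedAddCommGroup E] [NormedSpace ℂ E]
    {u v : ℝ → E} (hu : Integrable u volume) (hv : Integrable v volume)
    (h : ∀ s t, u t - u s = ∫ r in s..t, v r) : ∫ r, v r = 0 := by
  have htop : Tendsto u atTop (𝓝 (u 0 + ∫ r in Ioi 0, v r)) := by
    have h1 := intervalIntegral_tendsto_integral_Ioi 0 hv.integrableOn tendsto_id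
    refine (h1.const_add (u 0)).congr fun t => ?_
    rw [id, ← h 0 t]; abel
  have hbot : Tendsto u atBot (𝓝 (u 0 - ∫ r in Iic 0, v r)) := by
    have h1 := intervalIntegral_tendsto_integral_Iic 0 hv.integrableOn tendsto_id
    refine (h1.const_sub (u 0)).congr fun t => ?_
    rw [id, ← h t 0]; abel
  have z1 := IntegrableAtFilter.eq_zero_of_tendsto (μ := volume) (f := u) (l := atTop)
    (hu.integrableAtFilter _) (fun s hs => by
      obtain ⟨a, ha⟩ := mem_atTop_sets.1 hs
      exact measure_mono_top (fun x hx => ha x hx) (Real.volume_Ici (a := a))) htop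
  have z2 := IntegrableAtFilter.eq_zero_of_tendsto (μ := volume) (f := u) (l := atBot)
    (hu.integrableAtFilter _) (fun s hs => by
      obtain ⟨a, ha⟩ := mem_atBot_sets.1 hs
      exact measure_mono_top (fun x hx => ha x hx) (Real.volume_Iic (a := a))) hbot
  rw [← intervalIntegral.integral_Iic_add_Ioi (b := 0) hv.integrableOn hv.integrableOn]
  rw [← sub_eq_zero.1 z2, z1]

theorem norm_cexp_neg_I_mul (ω τ : ℝ) : ‖Complex.exp (-(Complex.I * ω * τ))‖ = 1 := by
  rw [Complex.norm_exp]; simp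

/-- The total derivative of `exp(-jωτ) u(τ)` integrates to zero over the line, so integration by
parts leaves no boundary terms. -/
theorem IsBoundedSolution.fourier_eq {E : Type*} [NormedAddCommGroup E] [NormedSpace ℂ E]
    [CompleteSpace E] {M : E →L[ℂ] E} {g u : ℝ → E} (h : IsBoundedSolution M g u)
    (hg : Integrable g volume) (hu : Integrable u volume) (ω : ℝ) :
    (Complex.I * ω) • (∫ τ : ℝ, Complex.exp (-(Complex.I * ω * τ)) • u τ) =
      M (∫ τ : ℝ, Complex.exp (-(Complex.I * ω * τ)) • u τ) +
        ∫ τ : ℝ, Complex.exp (-(Complex.I * ω * τ)) • g τ := by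
  set φ : ℝ → ℂ := fun τ => Complex.exp (-(Complex.I * ω * τ)) with hφ
  have hφc : Continuous φ := by fun_prop
  have hφi : ∀ {f : ℝ → E}, Integrable f volume → Integrable (fun τ => φ τ • f τ) volume :=
    fun hf => hf.bdd_smul 1 hφc.aestronglyMeasurable
      (Eventually.of_forall fun τ => (norm_cexp_neg_I_mul ω τ).le)
  have hd : ∀ τ, HasDerivAt φ (-(Complex.I * ω) * φ τ) τ := fun τ => by
    have : HasDerivAt (fun r : ℝ => -(Complex.I * ω * (r : ℂ))) (-(Complex.I * ω)) τ := by
      simpa using ((Complex.ofRealCLM.hasDerivAt (x := τ)).const_mul (Complex.I * ω)).fun_neg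
    simpa [hφ, mul_comm] using this.cexp
  have hMu : Integrable (fun τ => M (u τ)) volume := M.integrable_comp hu
  have h0 := integral_deriv_eq_zero_of_integrable (hφi hu)
    (v := fun r => (-(Complex.I * ω) * φ r) • u r + φ r • (M (u r) + g r))
    (by
      refine Integrable.add ?_ (hφi (hMu.add hg))
      simp_rw [mul_smul]
      exact (hφi hu).fun_smul _)
    (smul_sub_smul_eq_integral_of_primitive hd (by fun_prop) (h.locallyIntegrable hg)
      h.integral_eq)
  have e : ∀ r, (-(Complex.I * ω) * φ r) • u r + φ r • (M (u r) + g r) =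
      -(Complex.I * ω) • (φ r • u r) + (M (φ r • u r) + φ r • g r) := fun r => by
    rw [mul_smul, smul_add, map_smul]
  simp_rw [e] at h0
  have i1 : Integrable (fun r => -(Complex.I * ω) • (φ r • u r)) volume := (hφi hu).fun_smul _
  have i2 : Integrable (fun r => M (φ r • u r)) volume := M.integrable_comp (hφi hu)
  rw [integral_add i1 (i2.fun_add (hφi hg)), integral_add i2 (hφi hg), integral_smul,
    M.integral_comp_comm (hφi hu), neg_smul, neg_add_eq_zero] at h0
  exact h0

/-- The action of a real matrix on complex vectors. -/
noncomputable def complexAction {ι : Type*} [Fintype ι] [DecidableEq ι] (M : Matrix ι ι ℝ) :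
    (ι → ℂ) →L[ℂ] (ι → ℂ) :=
  LinearMap.toContinuousLinearMap (Matrix.toLin' (M.map Complex.ofReal))

variable {ι : Type*} [Fintype ι]

theorem intervalIntegral_apply {F : Type*} [NormedAddCommGroup F] [NormedSpace ℝ F]
    [CompleteSpace F] {v : ℝ → ι → F} {s t : ℝ}
    (hv : ∀ p, IntervalIntegrable (fun r => v r p) volume s t)
    (p : ι) : (∫ r in s..t, v r) p = ∫ r in s..t, v r p := by
  have hi : IntervalIntegrable v volume s t := by
    rw [intervalIntegrable_iff]
    exact Integrable.of_eval fun p => (intervalIntegrable_iff.1 (hv p))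
  exact ((ContinuousLinearMap.proj (R := ℝ) (φ := fun _ : ι => F) p).intervalIntegral_comp_comm
    hi).symm

theorem spectralDensity_eq_apply {u : ℝ → ι → ℝ}
    (hu : Integrable (fun t p => (u t p : ℂ)) volume) (p : ι) (ω : ℝ) :
    (∫ τ : ℝ, Complex.exp (-(Complex.I * ω * τ)) • fun p => (u τ p : ℂ)) p =
      spectralDensity (fun t => u t p) ω := by
  refine ((ContinuousLinearMap.proj (R := ℂ) (φ := fun _ : ι => ℂ) p).integral_comp_comm
    (hu.bdd_smul 1 (by fun_prop)
      (Eventually.of_forall fun τ => (norm_cexp_neg_I_mul ω τ).le))).symm.trans ?_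
  simp [spectralDensity, mul_comm]

variable [DecidableEq ι] {M : Matrix ι ι ℝ}

theorem complexAction_apply (v : ι → ℂ) (p : ι) :
    complexAction M v p = ∑ q, (M p q : ℂ) * v q := by
  simp [complexAction, Matrix.mulVec, dotProduct]

theorem isBoundedSolution_of_real {g u : ℝ → ι → ℝ} (hbdd : ∃ C, ∀ p t, |u t p| ≤ C)
    (hint : ∀ p s t, IntervalIntegrable (fun r => ∑ q, M p q * u r q + g r p) volume s t)
    (heq : ∀ p s t, u t p = u s p + ∫ r in s..t, (∑ q, M p q * u r q + g r p)) :
    IsBoundedSolution (complexAction M) (fun t p => (g t p : ℂ)) (fun t p => (u t p : ℂ)) where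
  continuous := by
    refine continuous_pi fun p => Complex.continuous_ofReal.comp ?_
    -- Continuity is not a hypothesis: it is read off from the integrated equation.
    rw [show (fun t => u t p) = fun t => u 0 p + ∫ r in (0 : ℝ)..t, (∑ q, M p q * u r q + g r p)
      from funext (heq p 0)]
    exact continuous_const.add (intervalIntegral.continuous_primitive (hint p) 0)
  bounded := by
    obtain ⟨C, hC⟩ := hbdd
    refine ⟨|C|, fun t => (pi_norm_le_iff_of_nonneg (abs_nonneg C)).2 fun p => ?_⟩
    rw [Complex.norm_real]
    exact (hC p t).trans (le_abs_self C)
  integral_eq s t := by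
    have e : ∀ r p, (complexAction M (fun p => (u r p : ℂ)) + fun p => (g r p : ℂ)) p =
        ((∑ q, M p q * u r q + g r p : ℝ) : ℂ) := fun r p => by
      rw [Pi.add_apply, complexAction_apply]; push_cast; rfl
    funext p
    rw [Pi.add_apply, intervalIntegral_apply (fun p => ?_)]
    · simp_rw [e]
      rw [intervalIntegral.integral_ofReal, heq p s t]
      push_cast
      rfl
    · simp_rw [e]
      exact ⟨(hint p s t).1.ofReal, (hint p s t).2.ofReal⟩

/-- Cayley–Hamilton: the characteristic polynomial splits over `ℂ`, its roots are the eigenvalues,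
and it annihilates the matrix. -/
theorem IsHurwitz.exists_factorization (hM : IsHurwitz M) :
    ∃ L : List ℂ, (∀ l ∈ L, l.re < 0) ∧
      (L.map fun l => complexAction M - l • (1 : (ι → ℂ) →L[ℂ] (ι → ℂ))).prod = 0 := by
  set Mc := M.map Complex.ofReal with hMc
  let Φ : Matrix ι ι ℂ →ₐ[ℂ] ((ι → ℂ) →L[ℂ] (ι → ℂ)) :=
    (Module.End.toContinuousLinearMap (ι → ℂ)).toAlgHom.comp
      (Matrix.toLinAlgEquiv' : Matrix ι ι ℂ ≃ₐ[ℂ] _).toAlgHom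
  have hΦ : Φ Mc = complexAction M := rfl
  refine ⟨Mc.charpoly.roots.toList, fun l hl => hM l ?_, ?_⟩
  · rw [Matrix.mem_spectrum_iff_isRoot_charpoly]
    exact Polynomial.isRoot_of_mem_roots (Multiset.mem_toList.1 hl)
  · have hs : Mc.charpoly.Splits := IsAlgClosed.splits _
    have h1 : (Mc.charpoly.roots.toList.map fun l => Polynomial.X - Polynomial.C l).prod
        = Mc.charpoly := by
      rw [← Multiset.prod_coe, ← Multiset.map_coe, Multiset.coe_toList]
      exact (hs.eq_prod_roots_of_monic Mc.charpoly_monic).symm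
    have h2 := congrArg (fun p => Φ (Polynomial.aeval Mc p)) h1
    simp only [Matrix.aeval_self_charpoly, map_zero, map_list_prod, List.map_map] at h2
    rw [← h2]
    congr 1
    refine List.map_congr_left fun l _ => ?_
    simp [hΦ, Algebra.algebraMap_eq_smul_one]

theorem IsHurwitz.integrable_solution (hM : IsHurwitz M) {g u : ℝ → ι → ℂ}
    (hg : Integrable g volume) (h : IsBoundedSolution (complexAction M) g u) :
    Integrable u volume := by
  obtain ⟨L, hL, hL0⟩ := hM.exists_factorization
  exact (h.integrable_and_eq_zero L hL hg fun t => by rw [hL0]; rfl).1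

theorem IsHurwitz.solution_unique (hM : IsHurwitz M) {g u u' : ℝ → ι → ℂ}
    (hg : LocallyIntegrable g volume) (h : IsBoundedSolution (complexAction M) g u)
    (h' : IsBoundedSolution (complexAction M) g u') : u = u' := by
  obtain ⟨L, hL, hL0⟩ := hM.exists_factorization
  have hd := h.sub h' hg hg
  simp only [sub_self] at hd
  have := (hd.integrable_and_eq_zero L hL (integrable_zero _ _ _) fun t => by rw [hL0]; rfl).2 rfl
  funext t
  exact sub_eq_zero.1 (congrFun this t)

theorem IsBoundedSolution.spectralDensity_eq {g u : ℝ → ι → ℝ}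
    (hg : Integrable (fun t p => (g t p : ℂ)) volume)
    (hu : Integrable (fun t p => (u t p : ℂ)) volume)
    (h : IsBoundedSolution (complexAction M) (fun t p => (g t p : ℂ)) (fun t p => (u t p : ℂ)))
    (p : ι) (ω : ℝ) :
    Complex.I * ω * spectralDensity (fun t => u t p) ω =
      ∑ q, (M p q : ℂ) * spectralDensity (fun t => u t q) ω +
        spectralDensity (fun t => g t p) ω := by
  have := congrFun (h.fourier_eq hg hu ω) p
  rw [Pi.add_apply, Pi.smul_apply, complexAction_apply, spectralDensity_eq_apply hg] at this
  simpa only [spectralDensity_eq_apply hu, smul_eq_mul] using this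

end HurwitzSolution

/-! ### From the random equation to its correlations -/

section Correlations

open Filter Topology

variable {Ω : Type*} [MeasurableSpace Ω] {μ : Measure Ω}

/-- Supplies the joint measurability of the state that Fubini needs. Path continuity makes `x` the
limit of its samples on grids of mesh `1/(k+1)`; there are countably many sample times, so replacing
the samples by measurable versions costs one null set. -/
theorem aestronglyMeasurable_uncurry_of_ae_continuous (ν : Measure ℝ) [SFinite ν] [SFinite μ]
    {x : ℝ → Ω → ℝ} (hm : ∀ t, AEStronglyMeasurable (x t) μ)
    (hc : ∀ᵐ o ∂μ, Continuous fun t => x t o) :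
    AEStronglyMeasurable (fun q : ℝ × Ω => x q.1 q.2) (ν.prod μ) := by
  set y : ℝ → Ω → ℝ := fun t => (hm t).mk (x t) with hy
  have hym : ∀ t, Measurable (y t) := fun t => (hm t).stronglyMeasurable_mk.measurable
  set d : ℕ → ℝ → ℝ := fun k t => (⌊((k : ℝ) + 1) * t⌋ : ℝ) / ((k : ℝ) + 1) with hd
  refine AEMeasurable.aestronglyMeasurable ?_
  refine aemeasurable_of_tendsto_metrizable_ae (u := atTop)
    (f := fun k q => y (d k q.1) q.2) (fun k => ?_) ?_
  · have h1 : Measurable fun q : ℤ × Ω => y ((q.1 : ℝ) / ((k : ℝ) + 1)) q.2 :=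
      measurable_from_prod_countable_right fun n =>
        hym ((n : ℝ) / ((k : ℝ) + 1))
    have h2 : Measurable fun q : ℝ × Ω => (⌊((k : ℝ) + 1) * q.1⌋, q.2) :=
      (Int.measurable_floor.comp (measurable_fst.const_mul _)).prodMk measurable_snd
    exact (h1.comp h2).aemeasurable
  · have h1 : ∀ᵐ o ∂μ, ∀ (k : ℕ) (n : ℤ),
        x ((n : ℝ) / ((k : ℝ) + 1)) o = y ((n : ℝ) / ((k : ℝ) + 1)) o :=
      ae_all_iff.2 fun k => ae_all_iff.2 fun n => (hm _).ae_eq_mk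
    have h2 := Measure.quasiMeasurePreserving_snd (μ := ν) (ν := μ) |>.ae (h1.and hc)
    filter_upwards [h2] with q hq
    have hlim : Tendsto (fun k => d k q.1) atTop (𝓝 q.1) := by
      refine tendsto_iff_dist_tendsto_zero.2 (squeeze_zero (fun _ => dist_nonneg) (fun k => ?_)
        tendsto_one_div_add_atTop_nhds_zero_nat)
      have hk : (0 : ℝ) < (k : ℝ) + 1 := by positivity
      rw [dist_comm, Real.dist_eq, abs_of_nonneg, hd]
      · rw [le_div_iff₀ hk, sub_mul, div_mul_cancel₀ _ hk.ne']
        linarith [Int.lt_floor_add_one (((k : ℝ) + 1) * q.1)]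
      · rw [sub_nonneg, hd, div_le_iff₀ hk]
        linarith [Int.floor_le (((k : ℝ) + 1) * q.1)]
    refine ((hq.2.tendsto q.1).comp hlim).congr fun k => ?_
    exact hq.1 k _

theorem integral_abs_mul_le {f g : Ω → ℝ} (hf : MemLp f 2 μ) (hg : MemLp g 2 μ) :
    ∫ o, |f o * g o| ∂μ ≤ ∫ o, f o ^ 2 ∂μ + ∫ o, g o ^ 2 ∂μ := by
  rw [← integral_add hf.integrable_sq hg.integrable_sq]
  refine integral_mono (hf.integrable_mul hg).abs (hf.integrable_sq.add hg.integrable_sq)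
    fun o => ?_
  simp only
  rw [abs_mul]
  nlinarith [sq_nonneg (|f o| - |g o|), sq_abs (f o), sq_abs (g o), abs_nonneg (f o),
    abs_nonneg (g o)]

theorem integrable_uncurry_of_integral_norm_le (ν : Measure ℝ) [IsFiniteMeasure ν] [SFinite μ]
    {f : ℝ → Ω → ℝ} (hm : AEStronglyMeasurable (fun q : ℝ × Ω => f q.1 q.2) (ν.prod μ))
    (hi : ∀ t, Integrable (f t) μ) {C : ℝ} (hC : ∀ t, ∫ o, |f t o| ∂μ ≤ C) :
    Integrable (fun q : ℝ × Ω => f q.1 q.2) (ν.prod μ) := by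
  rw [integrable_prod_iff hm]
  refine ⟨Eventually.of_forall hi, ?_⟩
  refine (integrable_const C).mono' hm.norm.integral_prod_right' (Eventually.of_forall fun t => ?_)
  rw [Real.norm_of_nonneg (integral_nonneg fun _ => norm_nonneg _)]
  exact hC t

variable {N n : ℕ} {A : Matrix (Fin n) (Fin n) ℝ} {b c : Fin n → ℝ} {G : Matrix (Fin N) (Fin N) ℝ}

theorem IsNetworkTrajectory.integral_eq_apply {w : Fin N → ℝ → ℝ} {x : ℝ → Fin N × Fin n → ℝ}
    (h : IsNetworkTrajectory A b c G w x) (p : Fin N × Fin n) (s t : ℝ) :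
    x t p = x s p + ∫ r in s..t, (∑ q, networkStateMatrix A b c G p q * x r q
      + b p.2 * w p.1 r) := by
  have hx : ∀ q, Continuous fun r => x r q := continuous_pi_iff.1 h.continuous_state
  conv_lhs => rw [h.integral_eq s t, Pi.add_apply, intervalIntegral_apply (fun p =>
    LocallyIntegrable.intervalIntegrable_real (by
      simp only [Pi.add_apply, Matrix.mulVec, dotProduct]
      exact (continuous_finsetSum _ fun q _ => (hx q).const_mul _).locallyIntegrable.add
        ((h.locallyIntegrable_input p.1).smul (b p.2))) s t)]
  rfl

/-- The integrated equation is multiplied by `Z` and averaged; the uniform second-moment bounds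
justify exchanging expectation and time integral, and also bound the solution. -/
theorem correlation_isBoundedSolution [IsProbabilityMeasure μ]
    {w : Fin N → ℝ → Ω → ℝ} {Rw : ℝ → ℝ}
    (hwm : ∀ i, Measurable (fun q : ℝ × Ω => w i q.1 q.2))
    (hw : UncorrelatedWSSNoise μ w Rw) {x : ℝ → Ω → Fin N × Fin n → ℝ}
    (hx : ∀ᵐ o ∂μ, IsNetworkTrajectory A b c G (fun i t => w i t o) (fun t => x t o))
    (hxb : MeanSquareBounded μ x) {Z : Ω → ℝ} (hZ : MemLp Z 2 μ) :
    IsBoundedSolution (complexAction (networkStateMatrix A b c G))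
      (fun t p => ((b p.2 * ∫ o, w p.1 t o * Z o ∂μ : ℝ) : ℂ))
      (fun t p => ((∫ o, x t o p * Z o ∂μ : ℝ) : ℂ)) := by
  set M := networkStateMatrix A b c G
  obtain ⟨hxm, K, hK⟩ := hxb
  set V := ∫ o, Z o ^ 2 ∂μ with hV
  have hxZ : ∀ t p, Integrable (fun o => x t o p * Z o) μ := fun t p => (hxm t p).integrable_mul hZ
  have hwZ : ∀ t i, Integrable (fun o => w i t o * Z o) μ := fun t i =>
    (hw.memLp i t).integrable_mul hZ
  have hxC : ∀ p t, ∫ o, |x t o p * Z o| ∂μ ≤ K + V := fun p t =>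
    (integral_abs_mul_le (hxm t p) hZ).trans (by linarith [hK t p])
  have hwC : ∀ i t, ∫ o, |w i t o * Z o| ∂μ ≤ Rw 0 + V := fun i t => by
    refine (integral_abs_mul_le (hw.memLp i t) hZ).trans ?_
    have := hw.autocorr i t 0
    simp only [add_zero, ← sq] at this
    rw [this]
  have hZp : ∀ ν : Measure ℝ, [IsFiniteMeasure ν] →
      AEStronglyMeasurable (fun q : ℝ × Ω => Z q.2) (ν.prod μ) := fun ν _ =>
    hZ.1.comp_snd
  have hxP : ∀ (ν : Measure ℝ) [IsFiniteMeasure ν] p,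
      Integrable (fun q : ℝ × Ω => x q.1 q.2 p * Z q.2) (ν.prod μ) := fun ν _ p =>
    integrable_uncurry_of_integral_norm_le ν (f := fun t o => x t o p * Z o)
      ((aestronglyMeasurable_uncurry_of_ae_continuous ν (x := fun t o => x t o p)
        (fun t => (hxm t p).1)
        (hx.mono fun o ho => continuous_pi_iff.1 ho.continuous_state p)).mul (hZp ν))
      (fun t => hxZ t p) (hxC p)
  have hwP : ∀ (ν : Measure ℝ) [IsFiniteMeasure ν] i,
      Integrable (fun q : ℝ × Ω => w i q.1 q.2 * Z q.2) (ν.prod μ) := fun ν _ i =>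
    integrable_uncurry_of_integral_norm_le ν (f := fun t o => w i t o * Z o)
      ((hwm i).aestronglyMeasurable.mul (hZp ν)) (fun t => hwZ t i) (hwC i)
  have hfP : ∀ (ν : Measure ℝ) [IsFiniteMeasure ν] p,
      Integrable (fun q : ℝ × Ω => (∑ k, M p k * (x q.1 q.2 k * Z q.2))
        + b p.2 * (w p.1 q.1 q.2 * Z q.2)) (ν.prod μ) := fun ν _ p =>
    (integrable_finsetSum _ fun k _ => (hxP ν k).const_mul _).add ((hwP ν p.1).const_mul _)
  have hsec : ∀ r p, ∫ o, ((∑ k, M p k * (x r o k * Z o)) + b p.2 * (w p.1 r o * Z o)) ∂μ =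
      ∑ k, M p k * ∫ o, x r o k * Z o ∂μ + b p.2 * ∫ o, w p.1 r o * Z o ∂μ := fun r p => by
    rw [integral_add (integrable_finsetSum _ fun k _ => (hxZ r k).const_mul _)
      ((hwZ r p.1).const_mul _), integral_finsetSum _ fun k _ => (hxZ r k).const_mul _,
      integral_const_mul]
    simp_rw [integral_const_mul]
  refine isBoundedSolution_of_real ⟨K + V, fun p t => ?_⟩ (fun p s t => ?_) (fun p s t => ?_)
  · exact (abs_integral_le_integral_abs).trans (hxC p t)
  · have : IsFiniteMeasure ((volume : Measure ℝ).restrict (uIoc s t)) :=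
      ⟨by simp [uIoc]⟩
    simp_rw [← hsec]
    rw [intervalIntegrable_iff]
    exact (hfP (volume.restrict (uIoc s t)) p).integral_prod_left
  · have : IsFiniteMeasure ((volume : Measure ℝ).restrict (uIoc s t)) :=
      ⟨by simp [uIoc]⟩
    simp_rw [← hsec]
    rw [intervalIntegral_integral_swap (hfP (volume.restrict (uIoc s t)) p)]
    have hI : Integrable (fun o => ∫ r in s..t, ((∑ k, M p k * (x r o k * Z o))
        + b p.2 * (w p.1 r o * Z o))) μ := by
      simp_rw [intervalIntegral.intervalIntegral_eq_integral_uIoc, smul_eq_mul]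
      exact (hfP (volume.restrict (uIoc s t)) p).integral_prod_right.const_mul _
    rw [← integral_add (hxZ s p) hI]
    refine integral_congr_ae (hx.mono fun o ho => ?_)
    simp only
    rw [ho.integral_eq_apply p s t, add_mul, ← intervalIntegral.integral_mul_const]
    congr 1
    refine intervalIntegral.integral_congr fun r _ => ?_
    simp only [add_mul, Finset.sum_mul, mul_assoc, M]

end Correlations

/-! ### Rules for spectral densities -/

section SpectralDensity

open Filter Topology ComplexConjugate

theorem integrable_spectralDensity_integrand {R : ℝ → ℝ} (hR : Integrable R volume) (ω : ℝ) :
    Integrable (fun τ : ℝ => (R τ : ℂ) * Complex.exp (-(Complex.I * (ω : ℂ) * (τ : ℂ)))) volume := by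
  exact hR.ofReal.mul_bdd (c := 1) (by fun_prop)
    (Eventually.of_forall fun τ => (norm_cexp_neg_I_mul ω τ).le)

theorem spectralDensity_const_mul (a : ℝ) (R : ℝ → ℝ) (ω : ℝ) :
    spectralDensity (fun t => a * R t) ω = a * spectralDensity R ω := by
  simp only [spectralDensity, Complex.ofReal_mul, mul_assoc]
  exact integral_const_mul _ _

theorem spectralDensity_sum {κ : Type*} (s : Finset κ) {R : κ → ℝ → ℝ}
    (hR : ∀ k ∈ s, Integrable (R k) volume) (ω : ℝ) :
    spectralDensity (fun t => ∑ k ∈ s, R k t) ω = ∑ k ∈ s, spectralDensity (R k) ω := by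
  simp only [spectralDensity, Complex.ofReal_sum, Finset.sum_mul]
  exact integral_finsetSum _ fun k hk => integrable_spectralDensity_integrand (hR k hk) ω

theorem spectralDensity_comp_neg (R : ℝ → ℝ) (ω : ℝ) :
    spectralDensity (fun t => R (-t)) ω = conj (spectralDensity R ω) := by
  unfold spectralDensity
  rw [← integral_conj, ← integral_neg_eq_self]
  refine integral_congr_ae (Eventually.of_forall fun τ => ?_)
  simp [← Complex.exp_conj]

end SpectralDensity

/-! ### Frequency-domain algebra of the network -/

section NetworkAlgebra

open ComplexConjugate

theorem WeightedDigraph.neg_laplacian_mulVec_one {V : Type*} [Fintype V] [DecidableEq V]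
    (D : WeightedDigraph V) : (-D.laplacian).map Complex.ofReal *ᵥ 1 = 0 := by
  have h : (-D.laplacian) *ᵥ 1 = 0 := by
    funext i
    simp [WeightedDigraph.laplacian, WeightedDigraph.inDegree, WeightedDigraph.adjacency,
      Matrix.mulVec, dotProduct, Matrix.diagonal]
  funext i
  have := congrArg Complex.ofReal (congrFun h i)
  simpa [Matrix.mulVec, dotProduct] using this

theorem nodalTransfer_mul {n : ℕ} {A : Matrix (Fin n) (Fin n) ℝ} {b c : Fin n → ℝ} {ω : ℝ}
    (hne : nodalTransfer A b c ω ≠ 0) {v : Fin n → ℂ} {d : ℂ}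
    (hv : ∀ k, Complex.I * ω * v k = ∑ l, (A k l : ℂ) * v l + b k * d) :
    ∑ k, (c k : ℂ) * v k = nodalTransfer A b c ω * d := by
  set P : Matrix (Fin n) (Fin n) ℂ := (Complex.I * (ω : ℂ)) • 1 - A.map Complex.ofReal with hP
  have hu : IsUnit P.det := by
    -- The inverse of a singular matrix is `0` by convention, which would make the transfer function
    -- vanish; so `jω` is not an eigenvalue of `A`.
    by_contra h
    refine hne ?_
    rw [nodalTransfer, ← hP, Matrix.nonsing_inv_apply_not_isUnit P h]
    simp
  have h1 : P *ᵥ v = d • fun k => (b k : ℂ) := by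
    funext k
    have := hv k
    rw [hP, Matrix.sub_mulVec, Matrix.smul_mulVec, Matrix.one_mulVec, Pi.sub_apply,
      Pi.smul_apply, Pi.smul_apply, smul_eq_mul, smul_eq_mul, this]
    simp only [Matrix.mulVec, dotProduct, Matrix.map_apply]
    ring
  have h2 : v = d • (P⁻¹ *ᵥ fun k => (b k : ℂ)) := by
    rw [← Matrix.mulVec_smul, ← h1, Matrix.mulVec_mulVec, Matrix.nonsing_inv_mul P hu,
      Matrix.one_mulVec]
  change (fun k => (c k : ℂ)) ⬝ᵥ v = _
  rw [h2, dotProduct_smul, smul_eq_mul, mul_comm]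
  rfl

theorem networkStateMatrix_sum {N n : ℕ} (A : Matrix (Fin n) (Fin n) ℝ) (b c : Fin n → ℝ)
    (G : Matrix (Fin N) (Fin N) ℝ) (i : Fin N) (k : Fin n) (v : Fin N × Fin n → ℂ) :
    ∑ q, (networkStateMatrix A b c G (i, k) q : ℂ) * v q =
      ∑ l, (A k l : ℂ) * v (i, l) + b k * ∑ j, (G i j : ℂ) * ∑ l, (c l : ℂ) * v (j, l) := by
  rw [Fintype.sum_prod_type]
  simp only [networkStateMatrix, Matrix.add_apply, Matrix.kroneckerMap_apply, Matrix.one_apply,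
    Matrix.vecMulVec_apply, Complex.ofReal_add, Complex.ofReal_mul, add_mul,
    Finset.sum_add_distrib]
  congr 1
  · rw [Finset.sum_eq_single i (fun j _ hj => by simp [hj.symm]) (by simp)]
    simp
  · simp only [Finset.mul_sum]
    exact Finset.sum_congr rfl fun j _ => Finset.sum_congr rfl fun l _ => by ring

/-- Closing the loop `v' = (I ⊗ A + G ⊗ b cᵀ) v + (I ⊗ b) d` in the frequency domain. -/
theorem output_eq_nodalTransfer_mul {N n : ℕ} {A : Matrix (Fin n) (Fin n) ℝ} {b c : Fin n → ℝ}
    {G : Matrix (Fin N) (Fin N) ℝ} {ω : ℝ} (hne : nodalTransfer A b c ω ≠ 0)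
    {v : Fin N × Fin n → ℂ} {d : Fin N → ℂ}
    (hv : ∀ p, Complex.I * ω * v p =
      ∑ q, (networkStateMatrix A b c G p q : ℂ) * v q + b p.2 * d p.1) (i : Fin N) :
    ∑ k, (c k : ℂ) * v (i, k) =
      nodalTransfer A b c ω * (∑ j, (G i j : ℂ) * (∑ l, (c l : ℂ) * v (j, l)) + d i) := by
  refine nodalTransfer_mul hne fun k => ?_
  rw [hv (i, k), networkStateMatrix_sum, mul_add, add_assoc]

/-- With `Q = 1 - hG`, the two feedback equations combine to `Q S Qᴴ = |h|² R·1`. Invertibility of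
`Q` and `S` follows from this identity and need not be assumed. -/
theorem cpsd_inverse_of_feedback {N : ℕ} (hN : 0 < N) {G T S : Matrix (Fin N) (Fin N) ℂ}
    {h R : ℂ} (hG : G *ᵥ 1 = 0) (hh : h ≠ 0) (hR : R ≠ 0) (hRc : conj R = R)
    (hT : T = h • (G * T + R • (1 : Matrix (Fin N) (Fin N) ℂ))) (hS : S = h • (G * S + Tᴴ)) :
    IsUnit S.det ∧ (1 : Fin N → ℂ) ⬝ᵥ (S⁻¹ *ᵥ 1) ≠ 0 ∧
      R = (N : ℂ) / (((1 : Fin N → ℂ) ⬝ᵥ (S⁻¹ *ᵥ 1)) * ((‖h‖ ^ 2 : ℝ) : ℂ)) := by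
  set Q : Matrix (Fin N) (Fin N) ℂ := 1 - h • G with hQ
  have hQT : Q * T = (h * R) • (1 : Matrix (Fin N) (Fin N) ℂ) := by
    rw [hQ, sub_mul, one_mul, smul_mul_assoc, sub_eq_iff_eq_add, mul_smul, ← smul_add, add_comm]
    exact hT
  have hQS : Q * S = h • Tᴴ := by
    rw [hQ, sub_mul, one_mul, smul_mul_assoc, sub_eq_iff_eq_add, ← smul_add, add_comm]
    exact hS
  have hQ1 : Q *ᵥ 1 = 1 := by
    rw [hQ, Matrix.sub_mulVec, Matrix.one_mulVec, Matrix.smul_mulVec, hG, smul_zero, sub_zero]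
  set r : ℂ := ((‖h‖ ^ 2 : ℝ) : ℂ) * R with hr
  have hh2 : ((‖h‖ ^ 2 : ℝ) : ℂ) = h * conj h := by
    rw [Complex.mul_conj, Complex.normSq_eq_norm_sq]
  have hh0 : ((‖h‖ ^ 2 : ℝ) : ℂ) ≠ 0 := by
    rw [hh2]; exact mul_ne_zero hh ((map_ne_zero _).2 hh)
  have hr0 : r ≠ 0 := mul_ne_zero hh0 hR
  have h1 : Q * (S * Qᴴ) = r • (1 : Matrix (Fin N) (Fin N) ℂ) := by
    rw [← mul_assoc, hQS, smul_mul_assoc, ← Matrix.conjTranspose_mul, hQT,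
      Matrix.conjTranspose_smul, Matrix.conjTranspose_one, smul_smul, hr, hh2]
    congr 1
    rw [star_mul', ← starRingEnd_apply, ← starRingEnd_apply, hRc, mul_assoc]
  have h2 : Q * (r⁻¹ • (S * Qᴴ)) = 1 := by
    rw [mul_smul_comm, h1, smul_smul, inv_mul_cancel₀ hr0, one_smul]
  -- For square matrices a right inverse is a left inverse, so `Q` can be moved from the left end of
  -- the product to the right.
  have h3 : S * (r⁻¹ • (Qᴴ * Q)) = 1 := by
    rw [mul_smul_comm, ← mul_assoc, ← smul_mul_assoc]
    exact mul_eq_one_comm.1 h2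
  have hinv : S⁻¹ = r⁻¹ • (Qᴴ * Q) := Matrix.inv_eq_right_inv h3
  have hval : (1 : Fin N → ℂ) ⬝ᵥ (S⁻¹ *ᵥ 1) = r⁻¹ * N := by
    have e1 : (1 : Fin N → ℂ) ᵥ* Qᴴ = 1 := by
      rw [Matrix.vecMul_conjTranspose, star_one, hQ1, star_one]
    rw [hinv, Matrix.smul_mulVec, dotProduct_smul, ← Matrix.mulVec_mulVec, hQ1,
      Matrix.dotProduct_mulVec, e1]
    simp
  have hN0 : (N : ℂ) ≠ 0 := Nat.cast_ne_zero.2 hN.ne'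
  refine ⟨?_, ?_, ?_⟩
  · exact Matrix.isUnit_det_of_right_inverse h3
  · rw [hval]
    exact mul_ne_zero (inv_ne_zero hr0) hN0
  · rw [hval, hr]
    field_simp

end NetworkAlgebra

/-! ### Stationarity and spectral equations of the state -/

section SteadyState

open Filter Topology ComplexConjugate

variable {Ω : Type*} [MeasurableSpace Ω] {μ : Measure Ω}

theorem UncorrelatedWSSNoise.correlation_eq {N : ℕ} {w : Fin N → ℝ → Ω → ℝ} {R : ℝ → ℝ}
    (hw : UncorrelatedWSSNoise μ w R) (i j : Fin N) (t s : ℝ) :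
    ∫ o, w i t o * w j s o ∂μ = if i = j then R (t - s) else 0 := by
  split_ifs with h
  · subst h
    rw [← hw.autocorr i s (t - s)]
    simp [mul_comm]
  · exact hw.uncorrelated i j h t s

theorem UncorrelatedWSSNoise.even {N : ℕ} {w : Fin N → ℝ → Ω → ℝ} {R : ℝ → ℝ}
    (hw : UncorrelatedWSSNoise μ w R) (hN : 0 < N) (τ : ℝ) : R (-τ) = R τ := by
  have h1 := hw.correlation_eq ⟨0, hN⟩ ⟨0, hN⟩ 0 τ
  have h2 := hw.correlation_eq ⟨0, hN⟩ ⟨0, hN⟩ τ 0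
  simp only [if_true, zero_sub, sub_zero] at h1 h2
  rw [← h1, ← h2]
  simp [mul_comm]

theorem integrable_complex_pi {ι : Type*} [Fintype ι] {g : ℝ → ι → ℝ}
    (hg : ∀ p, Integrable (fun t => g t p) volume) :
    Integrable (fun t p => (g t p : ℂ)) volume :=
  Integrable.of_eval fun p => (hg p).ofReal

theorem integrable_of_complex_pi {ι : Type*} [Fintype ι] {g : ℝ → ι → ℝ}
    (hg : Integrable (fun t p => (g t p : ℂ)) volume) (p : ι) :
    Integrable (fun t => g t p) volume := by
  simpa using (hg.eval p).re

/-- Uniqueness transports a family of bounded solutions whose forcings are translates of one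
another. -/
theorem IsHurwitz.solution_translate {ι : Type*} [Fintype ι] [DecidableEq ι] {M : Matrix ι ι ℝ}
    (hM : IsHurwitz M) {g : ℝ → ι → ℝ} {u : ℝ → ℝ → ι → ℝ}
    (hg : ∀ p, Integrable (fun t => g t p) volume)
    (h : ∀ s, IsBoundedSolution (complexAction M) (fun t p => (g (t - s) p : ℂ))
      (fun t p => (u s t p : ℂ))) (s t : ℝ) (p : ι) : u s t p = u 0 (t - s) p := by
  have h0 := (h 0).comp_add (-s)
  simp only [sub_zero, ← sub_eq_add_neg] at h0
  have := hM.solution_unique ((integrable_complex_pi hg).comp_sub_right s).locallyIntegrable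
    (h s) h0
  exact Complex.ofReal_injective (congrFun (congrFun this t) p)

variable {N n : ℕ} {A : Matrix (Fin n) (Fin n) ℝ} {b c : Fin n → ℝ} {G : Matrix (Fin N) (Fin N) ℝ}

/-- The second-order theory of the steady state: the state is centred, its correlations depend on
the time difference only, are integrable, and their spectral densities solve the linear system
obtained from the state equation. -/
theorem exists_state_correlations [IsProbabilityMeasure μ] {w : Fin N → ℝ → Ω → ℝ} {R : ℝ → ℝ}
    (hM : IsHurwitz (networkStateMatrix A b c G))
    (hwm : ∀ i, Measurable (fun q : ℝ × Ω => w i q.1 q.2))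
    (hw : UncorrelatedWSSNoise μ w R) (hR : Integrable R volume)
    {x : ℝ → Ω → Fin N × Fin n → ℝ}
    (hx : ∀ᵐ o ∂μ, IsNetworkTrajectory A b c G (fun i t => w i t o) (fun t => x t o))
    (hxb : MeanSquareBounded μ x) :
    (∀ t p, ∫ o, x t o p ∂μ = 0) ∧
    ∃ (k : Fin N → ℝ → Fin N × Fin n → ℝ) (r : Fin N × Fin n → ℝ → Fin N × Fin n → ℝ),
      (∀ s t p q, ∫ o, x t o p * x s o q ∂μ = r q (t - s) p) ∧
      (∀ q p, Integrable (fun t => r q t p) volume) ∧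
      (∀ j ω p, Complex.I * ω * spectralDensity (fun t => k j t p) ω =
        ∑ q, (networkStateMatrix A b c G p q : ℂ) * spectralDensity (fun t => k j t q) ω
          + b p.2 * (if p.1 = j then spectralDensity R ω else 0)) ∧
      (∀ q ω p, Complex.I * ω * spectralDensity (fun t => r q t p) ω =
        ∑ q', (networkStateMatrix A b c G p q' : ℂ) * spectralDensity (fun t => r q t q') ω
          + b p.2 * conj (spectralDensity (fun t => k p.1 t q) ω)) := by
  have hsol := fun {Z : Ω → ℝ} (hZ : MemLp Z 2 μ) =>
    correlation_isBoundedSolution hwm hw hx hxb hZ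
  refine ⟨fun t p => ?_, ?_⟩
  -- With `Z = 1` the forcing is zero, so the mean agrees with the zero solution.
  · have h1 := hsol (Z := fun _ => 1) (memLp_const 1)
    simp only [mul_one, hw.mean_zero, mul_zero] at h1
    have h0 : IsBoundedSolution (complexAction (networkStateMatrix A b c G))
        (fun _ _ => ((0 : ℝ) : ℂ)) (fun _ _ => ((0 : ℝ) : ℂ)) :=
      isBoundedSolution_of_real (g := fun _ _ => 0) (u := fun _ _ => 0) ⟨0, by simp⟩
        (by simp) (by simp)
    have := hM.solution_unique
      (integrable_complex_pi (g := fun _ _ => 0) (by simp)).locallyIntegrable h1 h0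
    exact Complex.ofReal_injective (congrFun (congrFun this t) p)
  -- state-input correlations
  let gk : Fin N → ℝ → Fin N × Fin n → ℝ := fun j t p => b p.2 * if p.1 = j then R t else 0
  have hgk : ∀ j p, Integrable (fun t => gk j t p) volume := fun j p => by
    refine Integrable.const_mul ?_ _
    split_ifs
    exacts [hR, integrable_zero _ _ _]
  have hk : ∀ j s, IsBoundedSolution (complexAction (networkStateMatrix A b c G))
      (fun t p => (gk j (t - s) p : ℂ))
      (fun t p => ((∫ o, x t o p * w j s o ∂μ : ℝ) : ℂ)) := fun j s => by
    simpa only [hw.correlation_eq] using hsol (hw.memLp j s)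
  let k : Fin N → ℝ → Fin N × Fin n → ℝ := fun j t p => ∫ o, x t o p * w j 0 o ∂μ
  have hkt : ∀ j s t p, ∫ o, x t o p * w j s o ∂μ = k j (t - s) p := fun j =>
    hM.solution_translate (u := fun s t p => ∫ o, x t o p * w j s o ∂μ) (hgk j) (hk j)
  have hk0 : ∀ j, IsBoundedSolution (complexAction (networkStateMatrix A b c G))
      (fun t p => (gk j t p : ℂ)) (fun t p => (k j t p : ℂ)) := fun j => by
    simpa only [sub_zero] using hk j 0
  have hki' := fun j => hM.integrable_solution (integrable_complex_pi (hgk j)) (hk0 j)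
  have hki := fun j => integrable_of_complex_pi (hki' j)
  -- state-state correlations
  let gr : Fin N × Fin n → ℝ → Fin N × Fin n → ℝ := fun q t p => b p.2 * k p.1 (-t) q
  have hgr : ∀ q p, Integrable (fun t => gr q t p) volume := fun q p =>
    (hki p.1 q).comp_neg.const_mul _
  have hr : ∀ q s, IsBoundedSolution (complexAction (networkStateMatrix A b c G))
      (fun t p => (gr q (t - s) p : ℂ))
      (fun t p => ((∫ o, x t o p * x s o q ∂μ : ℝ) : ℂ)) := fun q s => by
    -- The forcing `E(w(t) x_q(s))` is the state-input correlation at the reversed lag `s - t`.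
    have h1 := hsol (hxb.1 s q)
    simp_rw [mul_comm (w _ _ _) (x _ _ _), hkt] at h1
    simpa only [gr, neg_sub] using h1
  let r : Fin N × Fin n → ℝ → Fin N × Fin n → ℝ := fun q t p => ∫ o, x t o p * x 0 o q ∂μ
  have hrt : ∀ q s t p, ∫ o, x t o p * x s o q ∂μ = r q (t - s) p := fun q =>
    hM.solution_translate (u := fun s t p => ∫ o, x t o p * x s o q ∂μ) (hgr q) (hr q)
  have hr0 : ∀ q, IsBoundedSolution (complexAction (networkStateMatrix A b c G))
      (fun t p => (gr q t p : ℂ)) (fun t p => (r q t p : ℂ)) := fun q => by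
    simpa only [sub_zero] using hr q 0
  have hri' := fun q => hM.integrable_solution (integrable_complex_pi (hgr q)) (hr0 q)
  refine ⟨k, r, fun s t p q => hrt q s t p, fun q p => integrable_of_complex_pi (hri' q) p,
    fun j ω p => ?_, fun q ω p => ?_⟩
  · rw [(hk0 j).spectralDensity_eq (integrable_complex_pi (hgk j)) (hki' j) p ω,
      spectralDensity_const_mul]
    congr 2
    split_ifs
    · rfl
    · simp [spectralDensity]
  -- Time reversal becomes complex conjugation; this is the origin of `Tᴴ` in the equation for `S`.
  · rw [(hr0 q).spectralDensity_eq (integrable_complex_pi (hgr q)) (hri' q) p ω,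
      spectralDensity_const_mul, spectralDensity_comp_neg (fun t => k p.1 t q)]

end SteadyState

/-! ### Recovering the input density from the outputs -/

theorem corollary1 {N n : ℕ} (hN : 0 < N)
    {Ω : Type*} [MeasurableSpace Ω] (μ : Measure Ω) [IsProbabilityMeasure μ]
    -- the nodal dynamics and the directed graph
    (A : Matrix (Fin n) (Fin n) ℝ) (b c : Fin n → ℝ) (D : WeightedDigraph (Fin N))
    (hstable : IsHurwitz (networkStateMatrix A b c (-D.laplacian)))
    -- the input noise, with an auto-correlation function that has a Fourier transform
    (w : Fin N → ℝ → Ω → ℝ) (Rw : ℝ → ℝ)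
    (hw_meas : ∀ i, Measurable (fun q : ℝ × Ω => w i q.1 q.2))
    (hA1 : UncorrelatedWSSNoise μ w Rw) (hRw : Integrable Rw volume)
    (W : ℝ) (hA2 : IsExcitationInterval Rw W)
    -- the network state, in steady state
    (x : ℝ → Ω → Fin N × Fin n → ℝ)
    (hx : ∀ᵐ o ∂μ, IsNetworkTrajectory A b c (-D.laplacian)
      (fun i t => w i t o) (fun t => x t o))
    (hx_bdd : MeanSquareBounded μ x) :
    -- the cross-power spectral densities of the outputs exist
    JointlyWSS μ (networkOutput c x) ∧
    (∀ i j, Integrable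
      (crossCorrelation μ (networkOutput c x i) (networkOutput c x j)) volume) ∧
    -- every frequency of the excitation interval satisfies the first condition below
    ∀ ω : ℝ, spectralDensity Rw ω ≠ 0 → nodalTransfer A b c ω ≠ 0 →
      IsUnit (cpsdMatrix μ (networkOutput c x) ω).det ∧
      (1 : Fin N → ℂ) ⬝ᵥ ((cpsdMatrix μ (networkOutput c x) ω)⁻¹ *ᵥ 1) ≠ 0 ∧
      spectralDensity Rw ω =
        (N : ℂ) / (((1 : Fin N → ℂ) ⬝ᵥ ((cpsdMatrix μ (networkOutput c x) ω)⁻¹ *ᵥ 1)) *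
          ((‖nodalTransfer A b c ω‖ ^ 2 : ℝ) : ℂ)) := by
  obtain ⟨hmean, k, r, hr, hri, hk_eq, hr_eq⟩ :=
    exists_state_correlations hstable hw_meas hA1 hRw hx hx_bdd
  have hxm := hx_bdd.1
  have hcorr : ∀ i j s t, ∫ o, networkOutput c x i t o * networkOutput c x j s o ∂μ =
      ∑ l, c l * ∑ m, c m * r (j, l) (t - s) (i, m) := fun i j s t => by
    have hi : ∀ m l, Integrable (fun o => x t o (i, m) * x s o (j, l)) μ := fun m l =>
      (hxm t _).integrable_mul (hxm s _)
    have e : ∀ o, networkOutput c x i t o * networkOutput c x j s o =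
        ∑ l, c l * ∑ m, c m * (x t o (i, m) * x s o (j, l)) := fun o => by
      simp only [networkOutput, Finset.sum_mul, Finset.mul_sum]
      exact Finset.sum_congr rfl fun l _ => Finset.sum_congr rfl fun m _ => by ring
    simp_rw [e, ← hr]
    rw [integral_finsetSum _ fun l _ =>
      (integrable_finsetSum _ fun m _ => (hi m l).const_mul _).const_mul _]
    refine Finset.sum_congr rfl fun l _ => ?_
    rw [integral_const_mul, integral_finsetSum _ fun m _ => (hi m l).const_mul _]
    simp_rw [integral_const_mul]
  have hcross : ∀ i j, crossCorrelation μ (networkOutput c x i) (networkOutput c x j) =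
      fun τ => ∑ l, c l * ∑ m, c m * r (j, l) τ (i, m) := fun i j => by
    funext τ
    rw [crossCorrelation, hcorr]
    simp
  have hin : ∀ i j l, Integrable (fun τ => ∑ m, c m * r (j, l) τ (i, m)) volume := fun i j l =>
    integrable_finsetSum _ fun m _ => (hri _ _).const_mul _
  refine ⟨⟨fun i t => ?_, fun i s t => ?_, fun i j s t τ => ?_⟩, fun i j => ?_,
    fun ω hω hne => ?_⟩
  · exact memLp_finsetSum _ fun m _ => (hxm t (i, m)).const_mul (c m)
  · have h0 : ∀ t, ∫ o, networkOutput c x i t o ∂μ = 0 := fun t => by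
      simp only [networkOutput]
      rw [integral_finsetSum _ fun m _ =>
        ((hxm t (i, m)).integrable one_le_two).const_mul (c m)]
      simp_rw [integral_const_mul, hmean]
      simp
    rw [h0, h0]
  · rw [hcorr, hcorr]
    simp
  · rw [hcross]
    exact integrable_finsetSum _ fun l _ => (hin i j l).const_mul _
  -- `T i j` is the cross-spectral density of the output `y_i` with the input `w_j`.
  · set T : Matrix (Fin N) (Fin N) ℂ :=
      Matrix.of fun i j => ∑ m, (c m : ℂ) * spectralDensity (fun t => k j t (i, m)) ω with hT
    have hS : ∀ i j, cpsdMatrix μ (networkOutput c x) ω i j =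
        ∑ l, (c l : ℂ) * ∑ m, (c m : ℂ) * spectralDensity (fun t => r (j, l) t (i, m)) ω :=
      fun i j => by
      rw [cpsdMatrix, Matrix.of_apply, hcross,
        spectralDensity_sum _ fun l _ => (hin i j l).const_mul _]
      refine Finset.sum_congr rfl fun l _ => ?_
      rw [spectralDensity_const_mul, spectralDensity_sum _ fun m _ => (hri _ _).const_mul _]
      simp_rw [spectralDensity_const_mul]
    refine cpsd_inverse_of_feedback hN (T := T) D.neg_laplacian_mulVec_one hne hω ?_ ?_ ?_
    -- The autocorrelation is even, so its spectral density is real.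
    · rw [← spectralDensity_comp_neg]
      simp_rw [hA1.even hN]
    · ext i j
      have := output_eq_nodalTransfer_mul hne
        (v := fun p => spectralDensity (fun t => k j t p) ω)
        (d := fun i => if i = j then spectralDensity Rw ω else 0) (hk_eq j ω) i
      simpa [hT, Matrix.mul_apply, Matrix.one_apply] using this
    · ext i j
      -- The loop is closed in the first process with the second held at the state `(j, l)`;
      -- weighting by `c l` and summing turns that state into `y_j`.
      have h1 := fun l => output_eq_nodalTransfer_mul hne
        (v := fun p => spectralDensity (fun t => r (j, l) t p) ω)
        (d := fun i => starRingEnd ℂ (spectralDensity (fun t => k i t (j, l)) ω))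
        (hr_eq (j, l) ω) i
      rw [hS]
      simp_rw [h1]
      simp only [Matrix.smul_apply, Matrix.add_apply, Matrix.mul_apply, smul_eq_mul, hS, hT,
        Matrix.conjTranspose_apply, Matrix.of_apply, Matrix.map_apply, star_sum, star_mul',
        RCLike.star_def, Complex.conj_ofReal, mul_add, Finset.sum_add_distrib, Finset.mul_sum]
      congr 1
      · rw [Finset.sum_comm]
        refine Finset.sum_congr rfl fun i' _ => Finset.sum_congr rfl fun l _ =>
          Finset.sum_congr rfl fun m _ => by ring
      · exact Finset.sum_congr rfl fun l _ => by ring
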